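/- Let $d\ge 0$ be an integer. Let $A,B\in\{0,\dots,d\}$ and $i,j\in\{1,2\}$, let $\eta_{AB}=\eta^{AB}$ be the diagonal metric with entry $+1$ at $A=0$ and $A=d$ and $-1$ otherwise, and let $\epsilon^{12}=-\epsilon^{21}=1$. Indices are raised by $a^A=\eta^{AB}a_B$ and $a^i=\epsilon^{ij}a_j$, so that $a_ib^i=a_1b_2-a_2b_1$. Fix a real vector $V^A$ with $V_AV^A=1$, and for complex variables $Z=(Z^A_i)$, $Y=(Y^A_i)$ put $z_i=V_AZ^A_i$, $y_i=V_AY^A_i$. Let $K$ be $\mathbb R$ or $\mathbb C$. A function $f(Z,Y)$ of $Z,Y\in\mathbb C^{2(d+1)}$ is called *regular* (over $K$) if it is a finite sum of functions of the form $$P(Z,Y)\int_{M}\rho(\tau)\,\exp\big(\phi(\tau)\,z_iy^i\big)\,d^n\tau ,$$ where $n\ge 0$, $M\subset\mathbb R^n$ is compact, $\rho:\mathbb R^n\to\mathbb C$ is integrable on $M$, $P$ is a polynomial with complex coefficients, and $\phi$ is a polynomial with coefficients in $K$ (for $n=0$ the integral is evaluation at a point, so that for instance $\exp(-2z_iy^i)$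 is regular). The star product of $f$ and $g$ is $$(f*g)(Z,Y)=\frac1{\pi^{2(d+1)}}\int dS\,dT\;e^{-2S^A_iT^i_A}\,f(Z+S,Y+S)\,g(Z-T,Y+T),$$ where $S=e^{i\pi/4}s$, $T=e^{i\pi/4}t$ with $s,t$ running over $\mathbb R^{2(d+1)}$, $dS\,dT$ stands for the Lebesgue measure $ds\,dt$, and the oscillatory integral is understood as the limit, as $\varepsilon\to0^+$, of the integrals with the additional factor $e^{-\varepsilon(|s|^2+|t|^2)}$ in the integrand. The star product is said to exist if at every $(Z,Y)$ these integrals converge absolutely for all $\varepsilon>0$ and the limit exists. **Theorem.** If $f_1(Z,Y)$ and $f_2(Z,Y)$ are regular (over $K$), then the star product $f_1*f_2$ exists and is again a regular function (over $K$). -/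

import Mathlib

open MeasureTheory Filter Topology

noncomputable section

/-- Label of an oscillator component `Y^A_i`, with `A ∈ {0, …, d}` and `i ∈ {1, 2}`
(the values `1, 2` of `i` are `0, 1 : Fin 2`). -/
abbrev OscIdx (d : ℕ) : Type := Fin (d + 1) × Fin 2

/-- Complex values of one set of oscillator variables; `Z (A, i)` is `Z^A_i`. -/
abbrev Osc (d : ℕ) : Type := OscIdx d → ℂ

/-- Diagonal of the mostly minus metric `η_{AB} = η^{AB}` of `o(d-1,2)`; the two time-like
directions are `A = 0` and `A = d`. -/
def etaDiag (d : ℕ) (A : Fin (d + 1)) : ℝ :=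
  if A = 0 ∨ A = Fin.last d then 1 else -1

/-- `V^A V_A = η_{AB} V^A V^B`. -/
def normSqV {d : ℕ} (V : Fin (d + 1) → ℝ) : ℝ := ∑ A, etaDiag d A * V A * V A

/-- The projection `y_i = V_A Y^A_i = η_{AB} V^B Y^A_i`. -/
def proj {d : ℕ} (V : Fin (d + 1) → ℝ) (Y : Osc d) (i : Fin 2) : ℂ :=
  ∑ A, (etaDiag d A : ℂ) * (V A : ℂ) * Y (A, i)

/-- The components `ε^{ij}` of the `sp(2)` symplectic form, `ε^{12} = 1 = - ε^{21}`. -/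
def eps (i j : Fin 2) : ℂ := if i < j then 1 else if j < i then -1 else 0

/-- The contraction `a_i b^i`, where `b^i = ε^{ij} b_j`. -/
def spContract (a b : Fin 2 → ℂ) : ℂ := ∑ i, a i * ∑ j, eps i j * b j

/-- The contraction `S^A_i T^i_A = η_{AB} S^A_i ε^{ij} T^B_j`. -/
def fullContract {d : ℕ} (S T : Osc d) : ℂ :=
  ∑ A, (etaDiag d A : ℂ) * spContract (fun i => S (A, i)) (fun i => T (A, i))

/-- One term `P(Z,Y) ∫_M ρ(τ) exp(φ(τ) z_i y^i) dⁿτ`: here `M ⊆ ℝⁿ` is compact, `ρ` is integrable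
on `M`, and `P`, `φ` are polynomials, the coefficients of `φ` being taken from `K` (so `K` is
`ℝ` or `ℂ`). -/
def IsRegularOscTerm {d : ℕ} (K : Subalgebra ℝ ℂ) (V : Fin (d + 1) → ℝ)
    (f : Osc d → Osc d → ℂ) : Prop :=
  ∃ (P : MvPolynomial (OscIdx d ⊕ OscIdx d) ℂ) (n : ℕ) (M : Set (Fin n → ℝ))
    (ρ : (Fin n → ℝ) → ℂ) (φ : MvPolynomial (Fin n) ℂ),
    IsCompact M ∧ IntegrableOn ρ M volume ∧ (∀ m, φ.coeff m ∈ K) ∧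
    ∀ Z Y : Osc d, f Z Y = MvPolynomial.eval (Sum.elim Z Y) P *
      ∫ τ in M, ρ τ * Complex.exp (MvPolynomial.eval (fun k => (τ k : ℂ)) φ *
        spContract (proj V Z) (proj V Y))

/-- A regular function: a finite sum of terms `IsRegularOscTerm`. -/
def IsRegularOsc {d : ℕ} (K : Subalgebra ℝ ℂ) (V : Fin (d + 1) → ℝ)
    (f : Osc d → Osc d → ℂ) : Prop :=
  ∃ (N : ℕ) (g : Fin N → Osc d → Osc d → ℂ),
    (∀ k, IsRegularOscTerm K V (g k)) ∧ ∀ Z Y : Osc d, f Z Y = ∑ k, g k Z Y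

/-- The square root `e^{iπ/4}` of `i`. -/
def sqrtI : ℂ := Complex.exp ((Real.pi / 4 : ℝ) * Complex.I)

/-- The oscillator variable `√i · s` with `s` real: a point of the integration contour. -/
def onLine {d : ℕ} (s : OscIdx d → ℝ) : Osc d := fun a => sqrtI * (s a : ℂ)

/-- The integrand `e^{-2 S^A_i T^i_A} f(Z+S, Y+S) g(Z-T, Y+T)` of the star product, at
`S = √i s`, `T = √i t` with `s`, `t` real. -/
def starIntegrand {d : ℕ} (f g : Osc d → Osc d → ℂ) (Z Y : Osc d)
    (p : (OscIdx d → ℝ) × (OscIdx d → ℝ)) : ℂ :=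
  Complex.exp (-2 * fullContract (onLine p.1) (onLine p.2)) *
    f (Z + onLine p.1) (Y + onLine p.1) * g (Z - onLine p.2) (Y + onLine p.2)

/-- The Gaussian convergence factor `e^{-ε (|s|² + |t|²)}`. -/
def damping {d : ℕ} (ε : ℝ) (p : (OscIdx d → ℝ) × (OscIdx d → ℝ)) : ℂ :=
  (Real.exp (-ε * ((∑ a, p.1 a ^ 2) + ∑ a, p.2 a ^ 2)) : ℂ)

/-- `HasStarProduct f g h`: the star product of `f` and `g`,
`(f * g)(Z,Y) = π^{-2(d+1)} ∫ dS dT e^{-2 S^A_i T^i_A} f(Z+S, Y+S) g(Z-T, Y+T)`,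
exists at all `(Z, Y)` and equals `h`. The integral is over the lines `S, T ∈ √i ℝ^{2(d+1)}`, with
Lebesgue measure on them. The integrand does not decay (its modulus is `1` for `f = g = 1`), so
this is an oscillatory integral: the limit `ε → 0+` of the absolutely convergent integrals with
the factor `e^{-ε (|s|² + |t|²)}`. -/
def HasStarProduct {d : ℕ} (f g h : Osc d → Osc d → ℂ) : Prop :=
  ∀ Z Y : Osc d,
    (∀ ε : ℝ, 0 < ε → Integrable (fun p => damping ε p * starIntegrand f g Z Y p) volume) ∧
    Tendsto
      (fun ε : ℝ => ((Real.pi : ℂ) ^ (2 * (d + 1)))⁻¹ *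
        ∫ p, damping ε p * starIntegrand f g Z Y p)
      (𝓝[>] 0) (𝓝 (h Z Y))

end

/-! By bilinearity it suffices to multiply two terms, and after Fubini in the parameters τ it
suffices to multiply `P₁ exp(x z_i y^i)` by `P₂ exp(y z_i y^i)` with constants x, y. Shifting Z and
Y by the same S (or by -T and T) leaves the exponent at most linear in the shift, since `spContract`
is antisymmetric. So the only quadratic terms are the phase `-2 S T` and the damping. Both split
into pairs made of `s a` and `t (oscFlip d a)`, and the integral becomes a finite sum of products of
two-dimensional Gaussian moments (`damping_mul_exp_mul_monomial`, `integral_multiGauss`).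

Each moment is an explicit exponential times a polynomial in the sources, with coefficients
continuous up to `ε = 0` (`pairMoment_eq_closed`). At `ε = 0` the exponents of the pairs add up to
`x y z_i y^i`, because `V_A V^A = 1` (`sum_source_product`). Hence the product is a polynomial in Z,
Y, x, y times `exp((x + y + x y) z_i y^i)`, as in `exists_polynomial_starClosed_zero`.

Restoring τ, the new phase `φ₁ + φ₂ + φ₁ φ₂` again has coefficients in K, and powers of x and y are
absorbed into the density. Compactness of the parameter sets bounds x and y; this provides the
majorants for Fubini (`exists_integrable_starKernel_le`) and for the limit `ε → 0+`. -/

/-! ### Gaussian moments in one pair of conjugate variables. -/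

/-- A real majorant of `s ^ m * exp (-ε s² + γ s)`, uniform in `‖γ‖ ≤ D`. -/
noncomputable def gaussMajorant (ε D : ℝ) (m : ℕ) (s : ℝ) : ℝ := |s| ^ m * Real.exp (-ε * s ^ 2 + D * |s|)

lemma gaussMajorant_nonneg (ε D : ℝ) (m : ℕ) (s : ℝ) : 0 ≤ gaussMajorant ε D m s := by
  unfold gaussMajorant; positivity

/-- Half of the damping absorbs the linear term: completing the square gives `D|s| ≤ ε s²/2 +
D²/(2ε)`. -/
lemma integrable_gaussMajorant {ε : ℝ} (hε : 0 < ε) (D : ℝ) (m : ℕ) :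
    Integrable (gaussMajorant ε D m) := by
  have h1 : Integrable (fun s : ℝ => s ^ m * Real.exp (-(ε / 2) * s ^ 2)) := by
    have := integrable_rpow_mul_exp_neg_mul_sq (half_pos hε) (s := (m : ℝ))
      (by have : (0 : ℝ) ≤ m := Nat.cast_nonneg m
          linarith)
    simpa only [Real.rpow_natCast] using this
  refine (h1.norm.mul_const (Real.exp (D ^ 2 / (2 * ε)))).mono' ?_ (ae_of_all _ fun s => ?_)
  · unfold gaussMajorant
    exact Continuous.aestronglyMeasurable (by fun_prop)
  · rw [Real.norm_of_nonneg (gaussMajorant_nonneg _ _ _ _), norm_mul, norm_pow, Real.norm_eq_abs,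
      Real.norm_of_nonneg (Real.exp_pos _).le, mul_assoc, ← Real.exp_add]
    unfold gaussMajorant
    refine mul_le_mul_of_nonneg_left (Real.exp_le_exp.2 ?_) (by positivity)
    have h2 : D ^ 2 / (2 * ε) - D * |s| + ε / 2 * s ^ 2 = (D - ε * |s|) ^ 2 / (2 * ε) := by
      rw [← sq_abs s]; field_simp; ring
    have h3 : 0 ≤ (D - ε * |s|) ^ 2 / (2 * ε) := by positivity
    linarith

/-- The oscillatory Gaussian with monomial prefactor in one pair of conjugate real variables. -/
noncomputable def pairGauss (ε c : ℝ) (α β : ℂ) (m n : ℕ) (q : ℝ × ℝ) : ℂ :=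
  (q.1 : ℂ) ^ m * (q.2 : ℂ) ^ n * Complex.exp (-ε * ((q.1 : ℂ) ^ 2 + (q.2 : ℂ) ^ 2)
    - 2 * Complex.I * c * q.1 * q.2 + α * q.1 + β * q.2)

lemma continuous_pairGauss (ε c : ℝ) (α β : ℂ) (m n : ℕ) :
    Continuous (pairGauss ε c α β m n) := by
  unfold pairGauss; fun_prop

/-- The coupling `2 i c s t` is purely imaginary, so only damping and sources affect the modulus.
Uniformity in the sources is needed later for Fubini in τ. -/
lemma norm_pairGauss_le {ε c D : ℝ} {α β : ℂ} (hα : ‖α‖ ≤ D) (hβ : ‖β‖ ≤ D) (m n : ℕ) (q : ℝ × ℝ) :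
    ‖pairGauss ε c α β m n q‖ ≤ gaussMajorant ε D m q.1 * gaussMajorant ε D n q.2 := by
  have key : ∀ (γ : ℂ) (s : ℝ), ‖γ‖ ≤ D → (γ * s).re ≤ D * |s| := fun γ s hγ => by
    refine (Complex.re_le_norm _).trans ?_
    rw [norm_mul, Complex.norm_real, Real.norm_eq_abs]
    gcongr
  have hre : (-ε * ((q.1 : ℂ) ^ 2 + (q.2 : ℂ) ^ 2)
      - 2 * Complex.I * c * q.1 * q.2 + α * q.1 + β * q.2).re
      = -ε * (q.1 ^ 2 + q.2 ^ 2) + (α * q.1).re + (β * q.2).re := by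
    have e1 : (-ε * ((q.1 : ℂ) ^ 2 + (q.2 : ℂ) ^ 2)) = ((-ε * (q.1 ^ 2 + q.2 ^ 2) : ℝ) : ℂ) := by
      push_cast; ring
    have e2 : 2 * Complex.I * c * q.1 * q.2 = ((2 * c * q.1 * q.2 : ℝ) : ℂ) * Complex.I := by
      push_cast; ring
    rw [e1, e2]
    simp only [Complex.add_re, Complex.sub_re, Complex.ofReal_re, Complex.re_ofReal_mul,
      Complex.I_re, mul_zero, sub_zero]
  rw [pairGauss, norm_mul, norm_mul, norm_pow, norm_pow, Complex.norm_real, Complex.norm_real,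
    Complex.norm_exp, hre]
  calc _ ≤ |q.1| ^ m * |q.2| ^ n * Real.exp ((-ε * q.1 ^ 2 + D * |q.1|)
        + (-ε * q.2 ^ 2 + D * |q.2|)) := by
        rw [Real.norm_eq_abs, Real.norm_eq_abs]
        refine mul_le_mul_of_nonneg_left (Real.exp_le_exp.2 ?_) (by positivity)
        linarith [key α q.1 hα, key β q.2 hβ]
    _ = _ := by rw [Real.exp_add]; unfold gaussMajorant; ring

lemma integrable_pairGauss {ε : ℝ} (hε : 0 < ε) (c : ℝ) (α β : ℂ) (m n : ℕ) :
    Integrable (pairGauss ε c α β m n) :=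
  ((integrable_gaussMajorant hε (max ‖α‖ ‖β‖) m).mul_prod
    (integrable_gaussMajorant hε (max ‖α‖ ‖β‖) n)).mono'
    (continuous_pairGauss ε c α β m n).aestronglyMeasurable
    (ae_of_all _ fun q => norm_pairGauss_le (le_max_left _ _) (le_max_right _ _) m n q)

lemma integrable_pairGauss_left {ε : ℝ} (hε : 0 < ε) (c : ℝ) (α β : ℂ) (m n : ℕ) (t : ℝ) :
    Integrable (fun s : ℝ => pairGauss ε c α β m n (s, t)) :=
  ((integrable_gaussMajorant hε (max ‖α‖ ‖β‖) m).mul_const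
    (gaussMajorant ε (max ‖α‖ ‖β‖) n t)).mono'
    ((continuous_pairGauss ε c α β m n).comp (by fun_prop :
      Continuous fun s : ℝ => (s, t))).aestronglyMeasurable
    (ae_of_all _ fun s => norm_pairGauss_le (le_max_left _ _) (le_max_right _ _) m n (s, t))

lemma pairGauss_swap (ε c : ℝ) (α β : ℂ) (m n : ℕ) (q : ℝ × ℝ) :
    pairGauss ε c α β m n q.swap = pairGauss ε c β α n m q := by
  simp only [pairGauss, Prod.fst_swap, Prod.snd_swap]
  rw [mul_comm ((q.2 : ℂ) ^ m)]
  congr 2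
  ring

/-- The Gaussian moments in one pair of conjugate variables. -/
noncomputable def pairMoment (ε c : ℝ) (α β : ℂ) (m n : ℕ) : ℂ := ∫ q, pairGauss ε c α β m n q

lemma pairMoment_swap (ε c : ℝ) (α β : ℂ) (m n : ℕ) :
    pairMoment ε c α β m n = pairMoment ε c β α n m := by
  unfold pairMoment
  rw [Measure.volume_eq_prod, ← integral_prod_swap]
  simp only [pairGauss_swap]

lemma hasDerivAt_pairGauss (ε c : ℝ) (α β : ℂ) (m n : ℕ) (s t : ℝ) :
    HasDerivAt (fun s : ℝ => pairGauss ε c α β m n (s, t))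
      (m * pairGauss ε c α β (m - 1) n (s, t) + α * pairGauss ε c α β m n (s, t)
        - 2 * ε * pairGauss ε c α β (m + 1) n (s, t)
        - 2 * Complex.I * c * pairGauss ε c α β m (n + 1) (s, t)) s := by
  have h0 : HasDerivAt (fun s : ℝ => (s : ℂ)) 1 s := Complex.ofRealCLM.hasDerivAt
  have h1 := (h0.pow m).mul_const ((t : ℂ) ^ n)
  have h2 : HasDerivAt (fun s : ℝ => -(ε : ℂ) * ((s : ℂ) ^ 2 + (t : ℂ) ^ 2)
      - 2 * Complex.I * c * s * t + α * s + β * t)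
      (-(ε : ℂ) * (2 * s) - 2 * Complex.I * c * t + α) s := by
    have := (((((h0.pow 2).add_const ((t : ℂ) ^ 2)).const_mul (-(ε : ℂ))).sub
      ((h0.const_mul (2 * Complex.I * c)).mul_const (t : ℂ))).add (h0.const_mul α)).add_const
        (β * (t : ℂ))
    refine this.congr_deriv ?_
    simp
  refine (h1.mul h2.cexp).congr_deriv ?_
  simp only [pairGauss, Pi.pow_apply]
  ring

/-- Integration by parts: the integral of a total s-derivative vanishes. For `m = 0` the truncated
`m - 1` is harmless, its coefficient being zero. -/
lemma pairMoment_recurrence_aux {ε : ℝ} (hε : 0 < ε) (c : ℝ) (α β : ℂ) (m n : ℕ) :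
    m * pairMoment ε c α β (m - 1) n + α * pairMoment ε c α β m n
      - 2 * ε * pairMoment ε c α β (m + 1) n
      - 2 * Complex.I * c * pairMoment ε c α β m (n + 1) = 0 := by
  have hi := integrable_pairGauss hε c α β
  have hl := integrable_pairGauss_left hε c α β
  have e : ∫ q : ℝ × ℝ, (m * pairGauss ε c α β (m - 1) n q + α * pairGauss ε c α β m n q
        - 2 * ε * pairGauss ε c α β (m + 1) n q
        - 2 * Complex.I * c * pairGauss ε c α β m (n + 1) q) = 0 := by
    rw [Measure.volume_eq_prod, integral_prod_symm]
    · refine integral_eq_zero_of_ae (ae_of_all _ fun t => ?_)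
      refine integral_eq_zero_of_hasDerivAt_of_integrable
        (fun s => hasDerivAt_pairGauss ε c α β m n s t) ?_ (hl m n t)
      exact ((((hl _ _ t).const_mul _).add ((hl _ _ t).const_mul _)).sub
        ((hl _ _ t).const_mul _)).sub ((hl _ _ t).const_mul _)
    · exact ((((hi _ _).const_mul _).add ((hi _ _).const_mul _)).sub
        ((hi _ _).const_mul _)).sub ((hi _ _).const_mul _)
  have a1 := (hi (m - 1) n).const_mul (m : ℂ)
  have a2 := (hi m n).const_mul α
  have a3 := (hi (m + 1) n).const_mul (2 * ε : ℂ)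
  have a4 := (hi m (n + 1)).const_mul (2 * Complex.I * c)
  have a12 : Integrable (fun q => m * pairGauss ε c α β (m - 1) n q + α * pairGauss ε c α β m n q
      - 2 * ε * pairGauss ε c α β (m + 1) n q) := (a1.fun_add a2).sub a3
  rw [integral_sub a12 a4, integral_sub (a1.fun_add a2) a3,
    integral_add a1 a2] at e
  simpa only [integral_const_mul, pairMoment] using e

/-- The integrations by parts in s and in t form a linear system for the two next moments. Its
determinant `4(ε² + c²) = 4(ε² + 1)` stays nonzero at `ε = 0`. -/
lemma pairMoment_recurrence {ε : ℝ} (hε : 0 < ε) {c : ℝ} (hc : c ^ 2 = 1) (α β : ℂ) (m n : ℕ) :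
    pairMoment ε c α β (m + 1) n =
      ((ε / (2 * (ε ^ 2 + 1)) : ℝ) : ℂ) *
          (m * pairMoment ε c α β (m - 1) n + α * pairMoment ε c α β m n) +
        (-Complex.I * c * ((1 / (2 * (ε ^ 2 + 1)) : ℝ) : ℂ)) *
          (n * pairMoment ε c α β m (n - 1) + β * pairMoment ε c α β m n) := by
  have h1 := pairMoment_recurrence_aux hε c α β m n
  have h2 := pairMoment_recurrence_aux hε c β α n m
  simp only [← pairMoment_swap ε c α β] at h2
  have h3 : ((ε : ℂ) ^ 2 + 1) ≠ 0 := by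
    have : (ε ^ 2 + 1 : ℝ) ≠ 0 := by positivity
    exact_mod_cast this
  have hc' : (c : ℂ) ^ 2 = 1 := by exact_mod_cast hc
  push_cast
  field_simp
  -- These multipliers eliminate the moment of index `(m, n + 1)`.
  linear_combination (-(ε : ℂ)) * h1 + Complex.I * c * h2
    + 2 * pairMoment ε c α β (m + 1) n * (c ^ 2 * Complex.I_sq - hc')

/-- The polynomials `p m n` generated by the recurrence of the Gaussian moments. -/
def momentPoly {R : Type*} [CommRing R] (A B α β : R) : ℕ → ℕ → R
  | 0, 0 => 1
  | 0, n + 1 => A * (n * momentPoly A B α β 0 (n - 1) + β * momentPoly A B α β 0 n) +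
      B * (α * momentPoly A B α β 0 n)
  | m + 1, n => A * (m * momentPoly A B α β (m - 1) n + α * momentPoly A B α β m n) +
      B * (n * momentPoly A B α β m (n - 1) + β * momentPoly A B α β m n)
termination_by m n => (m, n)
decreasing_by all_goals simp_wf; omega

/-- The moments are defined over any commutative ring so that this naturality gives both continuity
(over `C(X, ℂ)`) and polynomial dependence on the sources (over `MvPolynomial`). -/
lemma map_momentPoly {R S : Type*} [CommRing R] [CommRing S] (f : R →+* S) (A B α β : R)
    (m n : ℕ) :
    f (momentPoly A B α β m n) = momentPoly (f A) (f B) (f α) (f β) m n := by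
  fun_induction momentPoly A B α β m n <;> rw [momentPoly] <;> simp_all

lemma continuous_momentPoly {X : Type*} [TopologicalSpace X] {A B α β : X → ℂ}
    (hA : Continuous A) (hB : Continuous B) (hα : Continuous α) (hβ : Continuous β) (m n : ℕ) :
    Continuous fun x => momentPoly (A x) (B x) (α x) (β x) m n := by
  have : (fun x => momentPoly (A x) (B x) (α x) (β x) m n)
      = fun x => (momentPoly (R := C(X, ℂ)) ⟨A, hA⟩ ⟨B, hB⟩ ⟨α, hα⟩ ⟨β, hβ⟩ m n) x := by
    funext x
    exact (map_momentPoly (ContinuousMap.evalAlgHom ℂ ℂ x : C(X, ℂ) →ₐ[ℂ] ℂ).toRingHom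
      ⟨A, hA⟩ ⟨B, hB⟩ ⟨α, hα⟩ ⟨β, hβ⟩ m n).symm
  rw [this]
  exact ContinuousMap.continuous _

lemma pairMoment_eq_momentPoly_mul {ε : ℝ} (hε : 0 < ε) {c : ℝ} (hc : c ^ 2 = 1) (α β : ℂ)
    (m n : ℕ) :
    pairMoment ε c α β m n =
      momentPoly ((ε / (2 * (ε ^ 2 + 1)) : ℝ) : ℂ)
        (-Complex.I * c * ((1 / (2 * (ε ^ 2 + 1)) : ℝ) : ℂ)) α β m n *
        pairMoment ε c α β 0 0 := by
  fun_induction momentPoly ((ε / (2 * (ε ^ 2 + 1)) : ℝ) : ℂ)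
        (-Complex.I * c * ((1 / (2 * (ε ^ 2 + 1)) : ℝ) : ℂ)) α β m n with
  | case1 => simp
  | case2 n ih1 ih2 =>
    rw [pairMoment_swap, pairMoment_recurrence hε hc]
    simp only [pairMoment_swap ε c β α]
    rw [ih1, ih2]
    push_cast
    ring
  | case3 m n ih1 ih2 ih3 =>
    rw [pairMoment_recurrence hε hc, ih1, ih2, ih3]
    ring

/-- Two successive one-dimensional Gaussian integrals. The one over s contributes `-c² t²/ε`, so
that t has the quadratic coefficient `ε + 1/ε`. -/
lemma pairMoment_zero_zero {ε : ℝ} (hε : 0 < ε) {c : ℝ} (hc : c ^ 2 = 1) (α β : ℂ) :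
    pairMoment ε c α β 0 0 = Real.pi * ((1 / √(ε ^ 2 + 1) : ℝ) : ℂ) *
      Complex.exp ((ε * α ^ 2 + ε * β ^ 2 - 2 * Complex.I * c * α * β) *
        ((1 / (4 * (ε ^ 2 + 1)) : ℝ) : ℂ)) := by
  have hε' : (ε : ℂ) ≠ 0 := by exact_mod_cast hε.ne'
  have h3 : ((ε : ℂ) ^ 2 + 1) ≠ 0 := by
    have : (ε ^ 2 + 1 : ℝ) ≠ 0 := by positivity
    exact_mod_cast this
  have hc' : (c : ℂ) ^ 2 = 1 := by exact_mod_cast hc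
  unfold pairMoment
  rw [Measure.volume_eq_prod, integral_prod_symm _ (integrable_pairGauss hε c α β 0 0)]
  have inner : ∀ t : ℝ, ∫ s : ℝ, pairGauss ε c α β 0 0 (s, t) =
      ((Real.pi / ε : ℝ) : ℂ) ^ (1 / 2 : ℂ) *
        Complex.exp (-((ε + 1 / ε : ℝ) : ℂ) * (t : ℂ) ^ 2 + (β - Complex.I * c * α / ε) * t
          + α ^ 2 / (4 * ε)) := fun t => by
    have := integral_cexp_quadratic (b := -(ε : ℂ)) (by simpa using hε)
      (α - 2 * Complex.I * c * t) (-ε * (t : ℂ) ^ 2 + β * t)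
    rw [show ((Real.pi / ε : ℝ) : ℂ) = Real.pi / - -(ε : ℂ) by push_cast; simp]
    convert this using 2
    · simp only [pairGauss, pow_zero, one_mul]
      funext s
      congr 1
      ring
    · congr 1
      push_cast
      field_simp
      linear_combination -4 * (t : ℂ) ^ 2 * (Complex.I ^ 2 * hc' + Complex.I_sq)
  simp only [inner]
  rw [integral_const_mul, integral_cexp_quadratic (by
    simp only [Complex.neg_re, Complex.ofReal_re, neg_lt_zero]; positivity)]
  rw [← mul_assoc]
  congr 1
  -- Both bases are positive reals, so the complex powers are real square roots and can be
  -- multiplied.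
  · rw [neg_neg, ← Complex.ofReal_div, show (1 / 2 : ℂ) = ((1 / 2 : ℝ) : ℂ) by push_cast; ring,
      ← Complex.ofReal_cpow (by positivity), ← Complex.ofReal_cpow (by positivity),
      ← Complex.ofReal_mul, ← Complex.ofReal_mul, ← Real.sqrt_eq_rpow, ← Real.sqrt_eq_rpow,
      ← Real.sqrt_mul (by positivity)]
    congr 1
    rw [show Real.pi / ε * (Real.pi / (ε + 1 / ε)) = Real.pi ^ 2 * (1 / (ε ^ 2 + 1)) by
      field_simp, Real.sqrt_mul (by positivity), Real.sqrt_sq Real.pi_pos.le,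
      Real.sqrt_div zero_le_one, Real.sqrt_one]
  · congr 1
    push_cast
    have h4 : (ε : ℂ) + 1 / ε ≠ 0 := by
      have : (ε + 1 / ε : ℝ) ≠ 0 := by positivity
      exact_mod_cast this
    have h5 : (ε : ℂ) + 1 / ε = (ε ^ 2 + 1) / ε := by field_simp
    rw [h5]
    field_simp
    linear_combination α ^ 2 * (Complex.I ^ 2 * hc' + Complex.I_sq)

/-! ### Products of pair Gaussians over all coordinates. -/

section MultiGauss

variable {ι : Type*} [Fintype ι]

/-- Pairing the coordinates `s a` and `t (σ a)`. -/
def pairCoords (σ : ι ≃ ι) : (ι → ℝ) × (ι → ℝ) ≃ᵐ (ι → ℝ × ℝ) :=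
  ((MeasurableEquiv.refl _).prodCongr (MeasurableEquiv.piCongrLeft (fun _ => ℝ) σ).symm).trans
    (MeasurableEquiv.arrowProdEquivProdArrow ℝ ℝ ι).symm

lemma measurePreserving_pairCoords (σ : ι ≃ ι) :
    MeasurePreserving (pairCoords σ) volume volume :=
  ((MeasurePreserving.id volume).prod
    (volume_measurePreserving_piCongrLeft (fun _ => ℝ) σ).symm).trans
    (volume_measurePreserving_arrowProdEquivProdArrow ℝ ℝ ι).symm

/-- Product over `a` of the Gaussians in the pairs of variables `s a`, `t (σ a)`. -/
noncomputable def multiGauss (σ : ι ≃ ι) (ε : ℝ) (c : ι → ℝ) (α β : ι → ℂ) (m n : ι → ℕ)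
    (p : (ι → ℝ) × (ι → ℝ)) : ℂ :=
  ∏ a, pairGauss ε (c a) (α a) (β a) (m a) (n a) (p.1 a, p.2 (σ a))

lemma integral_multiGauss (σ : ι ≃ ι) (ε : ℝ) (c : ι → ℝ) (α β : ι → ℂ) (m n : ι → ℕ) :
    ∫ p, multiGauss σ ε c α β m n p = ∏ a, pairMoment ε (c a) (α a) (β a) (m a) (n a) := by
  unfold pairMoment
  rw [← integral_fintype_prod_volume_eq_prod
    (fun a (q : ℝ × ℝ) => pairGauss ε (c a) (α a) (β a) (m a) (n a) q),
    ← (measurePreserving_pairCoords σ).integral_comp (pairCoords σ).measurableEmbedding]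
  rfl

lemma exists_integrable_multiGauss_le (σ : ι ≃ ι) {ε : ℝ} (hε : 0 < ε) (c : ι → ℝ) (D : ℝ)
    (m n : ι → ℕ) :
    ∃ G : (ι → ℝ) × (ι → ℝ) → ℝ, Integrable G ∧ ∀ α β : ι → ℂ, (∀ a, ‖α a‖ ≤ D) →
      (∀ a, ‖β a‖ ≤ D) → ∀ p, ‖multiGauss σ ε c α β m n p‖ ≤ G p := by
  refine ⟨fun p => ∏ a, gaussMajorant ε D (m a) (p.1 a) * gaussMajorant ε D (n a) (p.2 (σ a)),
    ?_, fun α β hα hβ p => ?_⟩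
  · have h : Integrable (fun q : ι → ℝ × ℝ => ∏ a, gaussMajorant ε D (m a) (q a).1 *
        gaussMajorant ε D (n a) (q a).2) :=
      Integrable.fintype_prod (μ := fun _ => volume)
        (f := fun a (q : ℝ × ℝ) => gaussMajorant ε D (m a) q.1 * gaussMajorant ε D (n a) q.2)
        fun a => (integrable_gaussMajorant hε D (m a)).mul_prod
          (integrable_gaussMajorant hε D (n a))
    exact ((measurePreserving_pairCoords σ).integrable_comp_emb
      (pairCoords σ).measurableEmbedding).2 h
  · unfold multiGauss
    rw [norm_prod]
    exact Finset.prod_le_prod (fun _ _ => norm_nonneg _)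
      fun a _ => norm_pairGauss_le (hα a) (hβ a) _ _ _

end MultiGauss

/-! ### Splitting the star-product exponent into conjugate pairs. -/

section Phases

variable {d : ℕ}

/-- The exchange of `(A, 1)` and `(A, 2)`. -/
def oscFlip (d : ℕ) : OscIdx d ≃ OscIdx d := (Equiv.refl _).prodCongr (Equiv.swap 0 1)

/-- The sign with which `S (A, i)` is coupled to its conjugate variable in `S^A_i T^i_A`. -/
noncomputable def oscSign (a : OscIdx d) : ℝ := etaDiag d a.1 * if a.2 = 0 then 1 else -1

lemma etaDiag_sq (A : Fin (d + 1)) : etaDiag d A ^ 2 = 1 := by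
  unfold etaDiag; split_ifs <;> norm_num

lemma oscSign_sq (a : OscIdx d) : oscSign a ^ 2 = 1 := by
  rw [oscSign, mul_pow, etaDiag_sq]; split_ifs <;> norm_num

lemma sqrtI_sq : sqrtI ^ 2 = Complex.I := by
  rw [sqrtI, ← Complex.exp_nat_mul]
  refine Eq.trans ?_ Complex.exp_pi_div_two_mul_I
  congr 1; push_cast; ring

lemma spContract_eq (a b : Fin 2 → ℂ) : spContract a b = a 0 * b 1 - a 1 * b 0 := by
  simp [spContract, eps, Fin.sum_univ_two]; ring

/-- The source coupled to `s` in the exponent of the first factor. -/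
noncomputable def leftSource (V : Fin (d + 1) → ℝ) (Z Y : Osc d) (x : ℂ) (a : OscIdx d) : ℂ :=
  x * (sqrtI * oscSign a * V a.1) *
    (proj V Y (Equiv.swap 0 1 a.2) - proj V Z (Equiv.swap 0 1 a.2))

/-- The source coupled to the conjugate variable of `s` in the exponent of the second factor. -/
noncomputable def rightSource (V : Fin (d + 1) → ℝ) (Z Y : Osc d) (x : ℂ) (a : OscIdx d) : ℂ :=
  x * (sqrtI * oscSign a * V a.1) * (proj V Z a.2 + proj V Y a.2)

lemma proj_add (V : Fin (d + 1) → ℝ) (Y W : Osc d) (i : Fin 2) :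
    proj V (Y + W) i = proj V Y i + proj V W i := by
  simp [proj, mul_add, Finset.sum_add_distrib]

lemma proj_sub (V : Fin (d + 1) → ℝ) (Y W : Osc d) (i : Fin 2) :
    proj V (Y - W) i = proj V Y i - proj V W i := by
  simp [proj, mul_sub, Finset.sum_sub_distrib]

/-- Z and Y move by the same vector, so the quadratic term is the contraction of a vector with
itself and vanishes. -/
lemma spContract_shift_left (V : Fin (d + 1) → ℝ) (Z Y : Osc d) (x : ℂ) (s : OscIdx d → ℝ) :
    x * spContract (proj V (Z + onLine s)) (proj V (Y + onLine s)) =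
      x * spContract (proj V Z) (proj V Y) + ∑ a, leftSource V Z Y x a * s a := by
  have h : ∑ a, leftSource V Z Y x a * s a =
      x * ((proj V Y 1 - proj V Z 1) * proj V (onLine s) 0
        - (proj V Y 0 - proj V Z 0) * proj V (onLine s) 1) := by
    rw [Fintype.sum_prod_type]
    have hp : ∀ i, proj V (onLine s) i =
      ∑ A, (etaDiag d A : ℂ) * (V A : ℂ) * onLine s (A, i) := fun _ => rfl
    simp only [Fin.sum_univ_two, hp, Finset.mul_sum, ← Finset.sum_sub_distrib]
    refine Finset.sum_congr rfl fun A _ => ?_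
    simp [leftSource, oscSign, onLine]
    ring
  rw [h]
  simp only [spContract_eq, proj_add]
  ring

lemma spContract_shift_right (V : Fin (d + 1) → ℝ) (Z Y : Osc d) (x : ℂ) (t : OscIdx d → ℝ) :
    x * spContract (proj V (Z - onLine t)) (proj V (Y + onLine t)) =
      x * spContract (proj V Z) (proj V Y) +
        ∑ a, rightSource V Z Y x a * t (oscFlip d a) := by
  have h : ∑ a, rightSource V Z Y x a * t (oscFlip d a) =
      x * ((proj V Z 0 + proj V Y 0) * proj V (onLine t) 1
        - (proj V Z 1 + proj V Y 1) * proj V (onLine t) 0) := by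
    rw [Fintype.sum_prod_type]
    have hp : ∀ i, proj V (onLine t) i =
      ∑ A, (etaDiag d A : ℂ) * (V A : ℂ) * onLine t (A, i) := fun _ => rfl
    simp only [Fin.sum_univ_two, hp, Finset.mul_sum, ← Finset.sum_sub_distrib]
    refine Finset.sum_congr rfl fun A _ => ?_
    simp [rightSource, oscSign, onLine, oscFlip]
    ring
  rw [h]
  simp only [spContract_eq, proj_add, proj_sub]
  ring

/-- The antisymmetric form couples `(A, 1)` only to `(A, 2)`, and `sqrtI ^ 2 = I` makes the exponent
imaginary on the contour. -/
lemma fullContract_onLine (s t : OscIdx d → ℝ) :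
    -2 * fullContract (onLine s) (onLine t) =
      ∑ a, -(2 * Complex.I * oscSign a * s a * t (oscFlip d a)) := by
  rw [Fintype.sum_prod_type, fullContract, Finset.mul_sum]
  refine Finset.sum_congr rfl fun A _ => ?_
  simp [spContract_eq, oscSign, onLine, oscFlip, Fin.sum_univ_two, ← sqrtI_sq]
  ring

/-- Summed over i, the zz and yy parts of `(y - z)(z + y)` cancel and the mixed parts double to `2
z_i y^i`. The sum over A then gives `V_A V^A = 1`. -/
lemma sum_source_product (V : Fin (d + 1) → ℝ) (hV : normSqV V = 1) (Z Y : Osc d) (x y : ℂ) :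
    ∑ a, -(2 * Complex.I * oscSign a * leftSource V Z Y x a * rightSource V Z Y y a) * (1 / 4) =
      x * y * spContract (proj V Z) (proj V Y) := by
  have hV' : ∑ A, (etaDiag d A : ℂ) * V A * V A = 1 := by
    rw [← Complex.ofReal_one, ← hV, normSqV]; push_cast; rfl
  rw [Fintype.sum_prod_type]
  trans ∑ A, (etaDiag d A : ℂ) * V A * V A * (x * y * spContract (proj V Z) (proj V Y))
  · refine Finset.sum_congr rfl fun A _ => ?_
    have h : (etaDiag d A : ℂ) ^ 2 = 1 := by exact_mod_cast etaDiag_sq A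
    simp [spContract_eq, leftSource, rightSource, oscSign, Fin.sum_univ_two]
    have h2 : sqrtI ^ 2 * Complex.I = -1 := by rw [sqrtI_sq, Complex.I_mul_I]
    have h3 : (etaDiag d A : ℂ) ^ 3 = etaDiag d A := by rw [pow_succ, h, one_mul]
    ring_nf
    simp only [h3, sqrtI_sq]
    ring_nf
    simp only [Complex.I_sq]
    ring
  · rw [← Finset.sum_mul, hV', one_mul]

lemma damping_mul_exp_mul_monomial (V : Fin (d + 1) → ℝ) (Z Y : Osc d) (ε : ℝ) (x y : ℂ)
    (m n : OscIdx d → ℕ) (p : (OscIdx d → ℝ) × (OscIdx d → ℝ)) :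
    damping ε p * Complex.exp (-2 * fullContract (onLine p.1) (onLine p.2)) *
      Complex.exp (x * spContract (proj V (Z + onLine p.1)) (proj V (Y + onLine p.1))) *
      Complex.exp (y * spContract (proj V (Z - onLine p.2)) (proj V (Y + onLine p.2))) *
      ((∏ a, (p.1 a : ℂ) ^ m a) * ∏ a, (p.2 (oscFlip d a) : ℂ) ^ n a) =
    Complex.exp ((x + y) * spContract (proj V Z) (proj V Y)) *
      multiGauss (oscFlip d) ε oscSign (leftSource V Z Y x) (rightSource V Z Y y) m n p := by
  -- Reindexing `|t|²` along the flip makes the damping split over the same pairs as the phase.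
  have h1 : (∑ a, p.2 a ^ 2) = ∑ a, p.2 (oscFlip d a) ^ 2 :=
    ((oscFlip d).sum_comp fun a => p.2 a ^ 2).symm
  simp only [multiGauss, pairGauss, Finset.prod_mul_distrib, ← Complex.exp_sum]
  rw [mul_comm, mul_left_comm (Complex.exp _)]
  congr 1
  rw [damping, Complex.ofReal_exp, ← Complex.exp_add, ← Complex.exp_add, ← Complex.exp_add,
    ← Complex.exp_add, spContract_shift_left, spContract_shift_right, fullContract_onLine, h1]
  congr 1
  push_cast
  simp only [Finset.sum_add_distrib, Finset.sum_sub_distrib, Finset.mul_sum, mul_add,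
    Finset.sum_neg_distrib]
  ring

end Phases

/-! ### Continuity of the moments down to ε = 0. -/

/-- Closed form of `pairMoment`, which makes sense at `ε = 0`. -/
noncomputable def pairMomentClosed (ε c : ℝ) (α β : ℂ) (m n : ℕ) : ℂ :=
  momentPoly ((ε / (2 * (ε ^ 2 + 1)) : ℝ) : ℂ)
    (-Complex.I * c * ((1 / (2 * (ε ^ 2 + 1)) : ℝ) : ℂ)) α β m n *
    (Real.pi * ((1 / √(ε ^ 2 + 1) : ℝ) : ℂ) *
      Complex.exp ((ε * α ^ 2 + ε * β ^ 2 - 2 * Complex.I * c * α * β) *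
        ((1 / (4 * (ε ^ 2 + 1)) : ℝ) : ℂ)))

lemma pairMoment_eq_closed {ε : ℝ} (hε : 0 < ε) {c : ℝ} (hc : c ^ 2 = 1) (α β : ℂ) (m n : ℕ) :
    pairMoment ε c α β m n = pairMomentClosed ε c α β m n := by
  rw [pairMoment_eq_momentPoly_mul hε hc, pairMoment_zero_zero hε hc, pairMomentClosed]

lemma pairMomentClosed_zero (c : ℝ) (α β : ℂ) (m n : ℕ) :
    pairMomentClosed 0 c α β m n =
      Real.pi * Complex.exp (-(2 * Complex.I * c * α * β) * (1 / 4)) *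
        momentPoly 0 (-Complex.I * c * (1 / 2)) α β m n := by
  simp [pairMomentClosed]
  ring

lemma continuous_pairMomentClosed {X : Type*} [TopologicalSpace X] {ε : X → ℝ} {α β : X → ℂ}
    (hε : Continuous ε) (c : ℝ) (hα : Continuous α) (hβ : Continuous β) (m n : ℕ) :
    Continuous fun x => pairMomentClosed (ε x) c (α x) (β x) m n := by
  have h0 : ∀ x, (ε x) ^ 2 + 1 ≠ 0 := fun x => by positivity
  have h1 : Continuous fun x => ((ε x / (2 * (ε x ^ 2 + 1)) : ℝ) : ℂ) :=
    Complex.continuous_ofReal.comp (hε.div (by fun_prop) fun x => by simpa using h0 x)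
  have h2 : Continuous fun x => ((1 / (2 * (ε x ^ 2 + 1)) : ℝ) : ℂ) :=
    Complex.continuous_ofReal.comp (continuous_const.div (by fun_prop) fun x => by simpa using h0 x)
  have h3 : Continuous fun x => ((1 / (4 * (ε x ^ 2 + 1)) : ℝ) : ℂ) :=
    Complex.continuous_ofReal.comp (continuous_const.div (by fun_prop) fun x => by simpa using h0 x)
  have h4 : Continuous fun x => ((1 / √(ε x ^ 2 + 1) : ℝ) : ℂ) :=
    Complex.continuous_ofReal.comp (continuous_const.div (by fun_prop) fun x =>
      (Real.sqrt_pos.2 (by positivity)).ne')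
  unfold pairMomentClosed
  exact (continuous_momentPoly h1 (continuous_const.mul h2) hα hβ m n).mul (by fun_prop)

/-! ### Star product of two polynomial-times-exponential functions. -/

section StarKernel

variable {d : ℕ}

/-- `P₁(Z + S, Y + S) P₂(Z - T, Y + T)` as a polynomial in `s`, `t`, `Z`, `Y`; the variable
`inl (inr a)` is the conjugate partner of the variable `inl (inl a)`. -/
noncomputable def shiftedProduct (P₁ P₂ : MvPolynomial (OscIdx d ⊕ OscIdx d) ℂ) :
    MvPolynomial ((OscIdx d ⊕ OscIdx d) ⊕ (OscIdx d ⊕ OscIdx d)) ℂ :=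
  MvPolynomial.bind₁ (Sum.elim
    (fun a => .X (.inr (.inl a)) + .C sqrtI * .X (.inl (.inl a)))
    (fun a => .X (.inr (.inr a)) + .C sqrtI * .X (.inl (.inl a)))) P₁ *
  MvPolynomial.bind₁ (Sum.elim
    (fun a => .X (.inr (.inl a)) - .C sqrtI * .X (.inl (.inr (oscFlip d a))))
    (fun a => .X (.inr (.inr a)) + .C sqrtI * .X (.inl (.inr (oscFlip d a))))) P₂

lemma oscFlip_oscFlip (a : OscIdx d) : oscFlip d (oscFlip d a) = a := by
  rcases a with ⟨A, i⟩
  simp [oscFlip]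

lemma eval_shiftedProduct (P₁ P₂ : MvPolynomial (OscIdx d ⊕ OscIdx d) ℂ) (Z Y : Osc d)
    (p : (OscIdx d → ℝ) × (OscIdx d → ℝ)) :
    MvPolynomial.eval (Sum.elim (Sum.elim (fun a => (p.1 a : ℂ))
        (fun a => (p.2 (oscFlip d a) : ℂ))) (Sum.elim Z Y)) (shiftedProduct P₁ P₂) =
      MvPolynomial.eval (Sum.elim (Z + onLine p.1) (Y + onLine p.1)) P₁ *
        MvPolynomial.eval (Sum.elim (Z - onLine p.2) (Y + onLine p.2)) P₂ := by
  rw [shiftedProduct, map_mul]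
  simp only [← MvPolynomial.coe_aeval_eq_eval, RingHom.coe_coe, MvPolynomial.aeval_bind₁]
  congr 3 <;> funext b <;> rcases b with b | b <;> simp [onLine, oscFlip_oscFlip]

/-- The damped integrand of the star product of `P₁ exp (x z_i y^i)` and `P₂ exp (y z_i y^i)`. -/
noncomputable def starKernel (V : Fin (d + 1) → ℝ) (P₁ P₂ : MvPolynomial (OscIdx d ⊕ OscIdx d) ℂ)
    (Z Y : Osc d) (ε : ℝ) (p : (OscIdx d → ℝ) × (OscIdx d → ℝ)) (x : ℂ × ℂ) : ℂ :=
  damping ε p * (Complex.exp (-2 * fullContract (onLine p.1) (onLine p.2)) *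
    (MvPolynomial.eval (Sum.elim (Z + onLine p.1) (Y + onLine p.1)) P₁ *
      Complex.exp (x.1 * spContract (proj V (Z + onLine p.1)) (proj V (Y + onLine p.1)))) *
    (MvPolynomial.eval (Sum.elim (Z - onLine p.2) (Y + onLine p.2)) P₂ *
      Complex.exp (x.2 * spContract (proj V (Z - onLine p.2)) (proj V (Y + onLine p.2)))))

lemma starKernel_eq_sum (V : Fin (d + 1) → ℝ) (P₁ P₂ : MvPolynomial (OscIdx d ⊕ OscIdx d) ℂ)
    (Z Y : Osc d) (ε : ℝ) (p : (OscIdx d → ℝ) × (OscIdx d → ℝ)) (x : ℂ × ℂ) :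
    starKernel V P₁ P₂ Z Y ε p x =
      Complex.exp ((x.1 + x.2) * spContract (proj V Z) (proj V Y)) *
        ∑ k ∈ (shiftedProduct P₁ P₂).support,
          (shiftedProduct P₁ P₂).coeff k * (∏ b, Sum.elim Z Y b ^ k (.inr b)) *
            multiGauss (oscFlip d) ε oscSign (leftSource V Z Y x.1) (rightSource V Z Y x.2)
              (fun a => k (.inl (.inl a))) (fun a => k (.inl (.inr a))) p := by
  have h := eval_shiftedProduct P₁ P₂ Z Y p
  rw [MvPolynomial.eval_eq'] at h
  have h2 : starKernel V P₁ P₂ Z Y ε p x =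
      (damping ε p * Complex.exp (-2 * fullContract (onLine p.1) (onLine p.2)) *
      Complex.exp (x.1 * spContract (proj V (Z + onLine p.1)) (proj V (Y + onLine p.1))) *
      Complex.exp (x.2 * spContract (proj V (Z - onLine p.2)) (proj V (Y + onLine p.2)))) *
      (MvPolynomial.eval (Sum.elim (Z + onLine p.1) (Y + onLine p.1)) P₁ *
        MvPolynomial.eval (Sum.elim (Z - onLine p.2) (Y + onLine p.2)) P₂) := by
    rw [starKernel]; ring
  rw [h2, ← h, Finset.mul_sum, Finset.mul_sum]
  refine Finset.sum_congr rfl fun k _ => ?_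
  rw [mul_left_comm (Complex.exp _), ← damping_mul_exp_mul_monomial, Fintype.prod_sum_type,
    Fintype.prod_sum_type (fun i : OscIdx d ⊕ OscIdx d => Sum.elim _ _ (Sum.inl i) ^ k (.inl i))]
  simp only [Sum.elim_inl, Sum.elim_inr]
  ring

lemma continuous_starKernel (V : Fin (d + 1) → ℝ)
    (P₁ P₂ : MvPolynomial (OscIdx d ⊕ OscIdx d) ℂ) (Z Y : Osc d) (ε : ℝ) :
    Continuous fun q : ((OscIdx d → ℝ) × (OscIdx d → ℝ)) × (ℂ × ℂ) =>
      starKernel V P₁ P₂ Z Y ε q.1 q.2 := by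
  simp only [starKernel_eq_sum, multiGauss, pairGauss, leftSource, rightSource]
  fun_prop

lemma exists_norm_source_le (V : Fin (d + 1) → ℝ) (Z Y : Osc d) (C : ℝ) :
    ∃ D, ∀ x : ℂ, ‖x‖ ≤ C → ∀ a, ‖leftSource V Z Y x a‖ ≤ D ∧ ‖rightSource V Z Y x a‖ ≤ D := by
  have h : ∀ x : ℂ, ‖x‖ ≤ C → ∀ a, ‖leftSource V Z Y x a‖ ≤ C * ‖leftSource V Z Y 1 a‖ ∧
      ‖rightSource V Z Y x a‖ ≤ C * ‖rightSource V Z Y 1 a‖ := fun x hx a => by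
    have h1 : leftSource V Z Y x a = x * leftSource V Z Y 1 a := by simp only [leftSource]; ring
    have h2 : rightSource V Z Y x a = x * rightSource V Z Y 1 a := by
      simp only [rightSource]; ring
    rw [h1, h2, norm_mul, norm_mul]
    constructor <;> gcongr
  -- The sources are linear in x, so their values at `x = 1` suffice. The sum over a bounds every
  -- component, and `|C|` keeps the terms nonnegative when C is negative.
  refine ⟨∑ a, (|C| * ‖leftSource V Z Y 1 a‖ + |C| * ‖rightSource V Z Y 1 a‖), fun x hx a => ?_⟩
  have h3 := Finset.single_le_sum (f := fun a =>
    |C| * ‖leftSource V Z Y 1 a‖ + |C| * ‖rightSource V Z Y 1 a‖)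
    (fun _ _ => by positivity) (Finset.mem_univ a)
  have h4 : 0 ≤ |C| * ‖leftSource V Z Y 1 a‖ := by positivity
  have h5 : 0 ≤ |C| * ‖rightSource V Z Y 1 a‖ := by positivity
  have h6 : C * ‖leftSource V Z Y 1 a‖ ≤ |C| * ‖leftSource V Z Y 1 a‖ := by
    gcongr; exact le_abs_self C
  have h7 : C * ‖rightSource V Z Y 1 a‖ ≤ |C| * ‖rightSource V Z Y 1 a‖ := by
    gcongr; exact le_abs_self C
  exact ⟨by linarith [(h x hx a).1], by linarith [(h x hx a).2]⟩

lemma exists_integrable_starKernel_le (V : Fin (d + 1) → ℝ)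
    (P₁ P₂ : MvPolynomial (OscIdx d ⊕ OscIdx d) ℂ) (Z Y : Osc d) {ε : ℝ} (hε : 0 < ε) (C : ℝ) :
    ∃ G : (OscIdx d → ℝ) × (OscIdx d → ℝ) → ℝ, Integrable G ∧
      ∀ x : ℂ × ℂ, ‖x‖ ≤ C → ∀ p, ‖starKernel V P₁ P₂ Z Y ε p x‖ ≤ G p := by
  obtain ⟨D, hD⟩ := exists_norm_source_le V Z Y C
  choose G hG hle using fun k : (OscIdx d ⊕ OscIdx d) ⊕ (OscIdx d ⊕ OscIdx d) →₀ ℕ =>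
    exists_integrable_multiGauss_le (oscFlip d) hε oscSign D
      (fun a => k (.inl (.inl a))) (fun a => k (.inl (.inr a)))
  refine ⟨fun p => Real.exp ((C + C) * ‖spContract (proj V Z) (proj V Y)‖) *
    ∑ k ∈ (shiftedProduct P₁ P₂).support,
      ‖(shiftedProduct P₁ P₂).coeff k * (∏ b, Sum.elim Z Y b ^ k (.inr b))‖ * G k p,
    (integrable_finsetSum _ fun k _ => (hG k).const_mul _).const_mul _, fun x hx p => ?_⟩
  have h1 : ‖x.1‖ ≤ C := (norm_fst_le x).trans hx
  have h2 : ‖x.2‖ ≤ C := (norm_snd_le x).trans hx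
  rw [starKernel_eq_sum, norm_mul]
  refine mul_le_mul ?_ ((norm_sum_le _ _).trans (Finset.sum_le_sum fun k _ => ?_))
    (norm_nonneg _) (Real.exp_pos _).le
  · rw [Complex.norm_exp]
    refine Real.exp_le_exp.2 ((Complex.re_le_norm _).trans ?_)
    rw [norm_mul]
    exact mul_le_mul_of_nonneg_right ((norm_add_le _ _).trans (add_le_add h1 h2)) (norm_nonneg _)
  · rw [norm_mul]
    exact mul_le_mul_of_nonneg_left (hle k _ _ (fun a => (hD _ h1 a).1) (fun a => (hD _ h2 a).2) p)
      (norm_nonneg _)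

/-- Closed form of the integral of `starKernel`, which makes sense at `ε = 0`. -/
noncomputable def starClosed (V : Fin (d + 1) → ℝ)
    (P₁ P₂ : MvPolynomial (OscIdx d ⊕ OscIdx d) ℂ) (Z Y : Osc d) (ε : ℝ) (x : ℂ × ℂ) : ℂ :=
  Complex.exp ((x.1 + x.2) * spContract (proj V Z) (proj V Y)) *
    ∑ k ∈ (shiftedProduct P₁ P₂).support,
      (shiftedProduct P₁ P₂).coeff k * (∏ b, Sum.elim Z Y b ^ k (.inr b)) *
        ∏ a, pairMomentClosed ε (oscSign a) (leftSource V Z Y x.1 a) (rightSource V Z Y x.2 a)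
          (k (.inl (.inl a))) (k (.inl (.inr a)))

lemma integral_starKernel (V : Fin (d + 1) → ℝ) (P₁ P₂ : MvPolynomial (OscIdx d ⊕ OscIdx d) ℂ)
    (Z Y : Osc d) {ε : ℝ} (hε : 0 < ε) (x : ℂ × ℂ) :
    ∫ p, starKernel V P₁ P₂ Z Y ε p x = starClosed V P₁ P₂ Z Y ε x := by
  simp only [starKernel_eq_sum]
  rw [integral_const_mul, integral_finsetSum, starClosed]
  · simp only [integral_const_mul, integral_multiGauss, pairMoment_eq_closed hε (oscSign_sq _)]
  · intro k _
    obtain ⟨D, hD⟩ := exists_norm_source_le V Z Y ‖x‖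
    obtain ⟨G, hG, hle⟩ := exists_integrable_multiGauss_le (oscFlip d) hε oscSign D
      (fun a => k (.inl (.inl a))) (fun a => k (.inl (.inr a)))
    refine Integrable.const_mul (hG.mono' ?_ (ae_of_all _ (hle _ _
      (fun a => (hD _ (norm_fst_le x) a).1) (fun a => (hD _ (norm_snd_le x) a).2)))) _
    refine Continuous.aestronglyMeasurable ?_
    unfold multiGauss pairGauss
    fun_prop

lemma continuous_starClosed (V : Fin (d + 1) → ℝ)
    (P₁ P₂ : MvPolynomial (OscIdx d ⊕ OscIdx d) ℂ) (Z Y : Osc d) :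
    Continuous fun q : ℝ × (ℂ × ℂ) => starClosed V P₁ P₂ Z Y q.1 q.2 := by
  unfold starClosed
  refine Continuous.mul (by fun_prop) (continuous_finsetSum _ fun k _ =>
    continuous_const.mul (continuous_finsetProd _ fun a _ => ?_))
  refine continuous_pairMomentClosed continuous_fst _ ?_ ?_ _ _
  · unfold leftSource; fun_prop
  · unfold rightSource; fun_prop

lemma exists_polynomial_source (V : Fin (d + 1) → ℝ) (a : OscIdx d) :
    ∃ L R : MvPolynomial ((OscIdx d ⊕ OscIdx d) ⊕ Fin 2) ℂ, ∀ (Z Y : Osc d) (x : ℂ × ℂ),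
      MvPolynomial.eval (Sum.elim (Sum.elim Z Y) ![x.1, x.2]) L = leftSource V Z Y x.1 a ∧
      MvPolynomial.eval (Sum.elim (Sum.elim Z Y) ![x.1, x.2]) R = rightSource V Z Y x.2 a := by
  refine ⟨.X (.inr 0) * .C (sqrtI * oscSign a * V a.1) *
    (∑ A, .C ((etaDiag d A : ℂ) * V A) * .X (.inl (.inr (A, Equiv.swap 0 1 a.2))) -
      ∑ A, .C ((etaDiag d A : ℂ) * V A) * .X (.inl (.inl (A, Equiv.swap 0 1 a.2)))),
    .X (.inr 1) * .C (sqrtI * oscSign a * V a.1) *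
    (∑ A, .C ((etaDiag d A : ℂ) * V A) * .X (.inl (.inl (A, a.2))) +
      ∑ A, .C ((etaDiag d A : ℂ) * V A) * .X (.inl (.inr (A, a.2)))), fun Z Y x => ⟨?_, ?_⟩⟩
  · simp only [map_mul, map_sub, map_sum, MvPolynomial.eval_X, MvPolynomial.eval_C, leftSource,
      proj, Sum.elim_inl, Sum.elim_inr, Matrix.cons_val_zero]
  · simp only [map_mul, map_add, map_sum, MvPolynomial.eval_X, MvPolynomial.eval_C, rightSource,
      proj, Sum.elim_inl, Sum.elim_inr, Matrix.cons_val_one, Matrix.cons_val_fin_one]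

/-- At `ε = 0` each of the `2(d + 1)` pairs gives a factor π, the cross terms add up by
`sum_source_product`, and the moments are evaluations of `momentPoly` taken over the polynomial
ring. -/
lemma exists_polynomial_starClosed_zero (V : Fin (d + 1) → ℝ) (hV : normSqV V = 1)
    (P₁ P₂ : MvPolynomial (OscIdx d ⊕ OscIdx d) ℂ) :
    ∃ R : MvPolynomial ((OscIdx d ⊕ OscIdx d) ⊕ Fin 2) ℂ, ∀ (Z Y : Osc d) (x : ℂ × ℂ),
      starClosed V P₁ P₂ Z Y 0 x = (Real.pi : ℂ) ^ (2 * (d + 1)) *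
        (MvPolynomial.eval (Sum.elim (Sum.elim Z Y) ![x.1, x.2]) R *
          Complex.exp ((x.1 + x.2 + x.1 * x.2) * spContract (proj V Z) (proj V Y))) := by
  choose L R hLR using exists_polynomial_source V
  refine ⟨∑ k ∈ (shiftedProduct P₁ P₂).support,
    .C ((shiftedProduct P₁ P₂).coeff k) * (∏ b, .X (.inl b) ^ k (.inr b)) *
      ∏ a, momentPoly 0 (.C (-Complex.I * oscSign a * (1 / 2))) (L a) (R a)
        (k (.inl (.inl a))) (k (.inl (.inr a))), fun Z Y x => ?_⟩
  have h1 : ∏ a, Complex.exp (-(2 * Complex.I * oscSign a * leftSource V Z Y x.1 a *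
      rightSource V Z Y x.2 a) * (1 / 4)) =
      Complex.exp (x.1 * x.2 * spContract (proj V Z) (proj V Y)) := by
    rw [← Complex.exp_sum, sum_source_product V hV]
  have h2 : Fintype.card (OscIdx d) = 2 * (d + 1) := by simp [mul_comm]
  simp only [starClosed, pairMomentClosed_zero, Finset.prod_mul_distrib, h1, Finset.prod_const,
    Finset.card_univ, h2, map_sum, map_mul, map_prod, map_pow, MvPolynomial.eval_X,
    MvPolynomial.eval_C, map_momentPoly, map_zero, (hLR _ Z Y x).1, (hLR _ Z Y x).2, Sum.elim_inl]
  rw [add_mul (x.1 + x.2), Complex.exp_add, Finset.mul_sum, Finset.sum_mul, Finset.mul_sum]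
  refine Finset.sum_congr rfl fun k _ => ?_
  ring

end StarKernel

/-! ### Integrability of superpositions over bounded parameters. -/

section Superposition

variable {X P : Type*} [MeasurableSpace X] [MeasurableSpace P] {μ : Measure X} {ν : Measure P}
  {ρ : X → ℂ} {x : X → ℂ × ℂ}

lemma integrable_mul_comp_of_bounded (hρ : Integrable ρ μ) (hx : Measurable x) {C : ℝ}
    (hC : ∀ᵐ τ ∂μ, ‖x τ‖ ≤ C) {F : ℂ × ℂ → ℂ} (hF : Continuous F) :
    Integrable (fun τ => ρ τ * F (x τ)) μ := by
  obtain ⟨B, hB⟩ := (isCompact_closedBall (0 : ℂ × ℂ) C).exists_bound_of_continuousOn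
    hF.continuousOn
  refine (hρ.norm.mul_const B).mono'
    (hρ.aestronglyMeasurable.mul (hF.measurable.comp hx).aestronglyMeasurable) ?_
  filter_upwards [hC] with τ hτ
  rw [norm_mul]
  exact mul_le_mul_of_nonneg_left (hB _ (by simpa using hτ)) (norm_nonneg _)

variable [TopologicalSpace P] [OpensMeasurableSpace P]

lemma integrable_superposition (hρ : Integrable ρ μ) (hx : Measurable x) {C : ℝ}
    (hC : ∀ᵐ τ ∂μ, ‖x τ‖ ≤ C) {k : P → ℂ × ℂ → ℂ}
    (hk : Continuous fun q : P × (ℂ × ℂ) => k q.1 q.2) {G : P → ℝ} (hG : Integrable G ν)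
    (hle : ∀ y : ℂ × ℂ, ‖y‖ ≤ C → ∀ p, ‖k p y‖ ≤ G p) :
    Integrable (Function.uncurry fun p τ => ρ τ * k p (x τ)) (ν.prod μ) := by
  refine (hG.mul_prod hρ.norm).mono' ?_ ?_
  · refine (hρ.aestronglyMeasurable.comp_snd).mul ?_
    exact (hk.measurable.comp
      (measurable_fst.prodMk (hx.comp measurable_snd))).aestronglyMeasurable
  · filter_upwards [Measure.quasiMeasurePreserving_snd.ae hC] with q hq
    rw [Function.uncurry_def, norm_mul, mul_comm]
    exact mul_le_mul_of_nonneg_right (hle _ hq _) (norm_nonneg _)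

end Superposition

/-! ### Closure properties of regular functions. -/

section RegularFunctions

variable {d : ℕ} {K : Subalgebra ℝ ℂ} {V : Fin (d + 1) → ℝ}

lemma IsRegularOscTerm.isRegularOsc {f : Osc d → Osc d → ℂ} (hf : IsRegularOscTerm K V f) :
    IsRegularOsc K V f :=
  ⟨1, fun _ => f, fun _ => hf, fun Z Y => by simp⟩

lemma IsRegularOsc.zero : IsRegularOsc K V (fun _ _ => 0 : Osc d → Osc d → ℂ) :=
  ⟨0, fun k => k.elim0, fun k => k.elim0, fun Z Y => by simp⟩

lemma IsRegularOsc.add {f g : Osc d → Osc d → ℂ} (hf : IsRegularOsc K V f)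
    (hg : IsRegularOsc K V g) : IsRegularOsc K V fun Z Y => f Z Y + g Z Y := by
  obtain ⟨N, u, hu, hfu⟩ := hf
  obtain ⟨N', u', hu', hgu⟩ := hg
  refine ⟨N + N', Fin.append u u', fun k => ?_, fun Z Y => ?_⟩
  · refine Fin.addCases (fun i => ?_) (fun i => ?_) k
    · rw [Fin.append_left]; exact hu i
    · rw [Fin.append_right]; exact hu' i
  · simp [Fin.sum_univ_add, hfu, hgu]

lemma IsRegularOsc.sum {κ : Type*} (s : Finset κ) {f : κ → Osc d → Osc d → ℂ}
    (hf : ∀ k ∈ s, IsRegularOsc K V (f k)) : IsRegularOsc K V fun Z Y => ∑ k ∈ s, f k Z Y := by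
  classical
  induction s using Finset.induction_on with
  | empty => simpa using IsRegularOsc.zero
  | insert a s ha ih =>
    simp only [Finset.sum_insert ha]
    exact (hf a (Finset.mem_insert_self a s)).add
      (ih fun k hk => hf k (Finset.mem_insert_of_mem hk))

lemma coeff_rename_mem {σ τ : Type*} {f : σ → τ} (hf : Function.Injective f)
    {φ : MvPolynomial σ ℂ} (hφ : ∀ m, φ.coeff m ∈ K) (m : τ →₀ ℕ) :
    (MvPolynomial.rename f φ).coeff m ∈ K := by
  by_cases h : ∃ u : σ →₀ ℕ, u.mapDomain f = m
  · obtain ⟨u, rfl⟩ := h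
    rw [MvPolynomial.coeff_rename_mapDomain f hf]
    exact hφ u
  · rw [MvPolynomial.coeff_rename_eq_zero f φ m fun u hu => absurd ⟨u, hu⟩ h]
    exact K.zero_mem

lemma coeff_mul_mem {σ : Type*} {φ ψ : MvPolynomial σ ℂ} (hφ : ∀ m, φ.coeff m ∈ K)
    (hψ : ∀ m, ψ.coeff m ∈ K) (m : σ →₀ ℕ) : (φ * ψ).coeff m ∈ K := by
  classical
  rw [MvPolynomial.coeff_mul]
  exact K.sum_mem fun q _ => K.mul_mem (hφ _) (hψ _)

/-- Splitting the coordinates of `ℝ^(n₁+n₂)`. -/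
def splitCoords (n₁ n₂ : ℕ) : (Fin (n₁ + n₂) → ℝ) ≃ᵐ (Fin n₁ → ℝ) × (Fin n₂ → ℝ) :=
  (MeasurableEquiv.piCongrLeft (fun _ => ℝ) finSumFinEquiv).symm.trans
    (MeasurableEquiv.sumPiEquivProdPi fun _ => ℝ)

lemma splitCoords_apply {n₁ n₂ : ℕ} (τ : Fin (n₁ + n₂) → ℝ) :
    splitCoords n₁ n₂ τ = (fun i => τ (Fin.castAdd n₂ i), fun i => τ (Fin.natAdd n₁ i)) := rfl

lemma measurePreserving_splitCoords (n₁ n₂ : ℕ) :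
    MeasurePreserving (splitCoords n₁ n₂) volume volume :=
  (volume_measurePreserving_piCongrLeft (fun _ => ℝ) finSumFinEquiv).symm.trans
    (volume_measurePreserving_sumPiEquivProdPi fun _ => ℝ)

/-- The splitting is only a measurable equivalence, so continuity of its inverse is checked on
coordinates; the preimage is then a continuous image of a compact set. -/
lemma isCompact_preimage_splitCoords {n₁ n₂ : ℕ} {M : Set ((Fin n₁ → ℝ) × (Fin n₂ → ℝ))}
    (hM : IsCompact M) : IsCompact (splitCoords n₁ n₂ ⁻¹' M) := by
  have hc : Continuous (splitCoords n₁ n₂).symm := by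
    refine continuous_pi fun i => ?_
    refine Fin.addCases (fun j => ?_) (fun j => ?_) i
    · have : (fun q => (splitCoords n₁ n₂).symm q (Fin.castAdd n₂ j)) = fun q => q.1 j := by
        funext q
        conv_rhs => rw [← (splitCoords n₁ n₂).apply_symm_apply q]
        rfl
      rw [this]; fun_prop
    · have : (fun q => (splitCoords n₁ n₂).symm q (Fin.natAdd n₁ j)) = fun q => q.2 j := by
        funext q
        conv_rhs => rw [← (splitCoords n₁ n₂).apply_symm_apply q]
        rfl
      rw [this]; fun_prop
  rw [← MeasurableEquiv.image_symm]
  exact hM.image hc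

/-- The parameters are concatenated into one compact set. The phase stays over K because K is closed
under sums and products. -/
lemma isRegularOscTerm_of_prod {n₁ n₂ : ℕ} {M₁ : Set (Fin n₁ → ℝ)} {M₂ : Set (Fin n₂ → ℝ)}
    (hM₁ : IsCompact M₁) (hM₂ : IsCompact M₂) (P : MvPolynomial (OscIdx d ⊕ OscIdx d) ℂ)
    {ρ : (Fin n₁ → ℝ) × (Fin n₂ → ℝ) → ℂ}
    (hρ : Integrable ρ ((volume.restrict M₁).prod (volume.restrict M₂)))
    {φ₁ : MvPolynomial (Fin n₁) ℂ} {φ₂ : MvPolynomial (Fin n₂) ℂ}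
    (hφ₁ : ∀ m, φ₁.coeff m ∈ K) (hφ₂ : ∀ m, φ₂.coeff m ∈ K) :
    IsRegularOscTerm K V fun Z Y => MvPolynomial.eval (Sum.elim Z Y) P *
      ∫ τ, ρ τ * Complex.exp ((MvPolynomial.eval (fun k => (τ.1 k : ℂ)) φ₁ +
        MvPolynomial.eval (fun k => (τ.2 k : ℂ)) φ₂ +
        MvPolynomial.eval (fun k => (τ.1 k : ℂ)) φ₁ * MvPolynomial.eval (fun k => (τ.2 k : ℂ)) φ₂) *
        spContract (proj V Z) (proj V Y)) ∂((volume.restrict M₁).prod (volume.restrict M₂)) := by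
  have hM : IsCompact (M₁ ×ˢ M₂) := hM₁.prod hM₂
  have hmp := (measurePreserving_splitCoords n₁ n₂).restrict_preimage hM.measurableSet
  have hr : (volume.restrict M₁).prod (volume.restrict M₂) =
      (volume : Measure ((Fin n₁ → ℝ) × (Fin n₂ → ℝ))).restrict (M₁ ×ˢ M₂) :=
    Measure.prod_restrict _ _
  rw [hr] at hρ ⊢
  have hi₁ := coeff_rename_mem (Fin.castAdd_injective n₁ n₂) hφ₁
  have hi₂ := coeff_rename_mem (Fin.natAdd_injective n₂ n₁) hφ₂
  refine ⟨P, n₁ + n₂, splitCoords n₁ n₂ ⁻¹' (M₁ ×ˢ M₂), ρ ∘ splitCoords n₁ n₂,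
    MvPolynomial.rename (Fin.castAdd n₂) φ₁ + MvPolynomial.rename (Fin.natAdd n₁) φ₂ +
      MvPolynomial.rename (Fin.castAdd n₂) φ₁ * MvPolynomial.rename (Fin.natAdd n₁) φ₂,
    isCompact_preimage_splitCoords hM,
    (hmp.integrable_comp_emb (splitCoords n₁ n₂).measurableEmbedding).2 hρ, fun m => ?_,
    fun Z Y => ?_⟩
  · rw [MvPolynomial.coeff_add, MvPolynomial.coeff_add]
    exact K.add_mem (K.add_mem (hi₁ m) (hi₂ m)) (coeff_mul_mem hi₁ hi₂ m)
  · beta_reduce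
    rw [← hmp.integral_comp (splitCoords n₁ n₂).measurableEmbedding]
    simp only [map_add, map_mul, MvPolynomial.eval_rename, splitCoords_apply, Function.comp_def]

/-- R is expanded into monomials: the Z, Y part becomes the polynomial prefactor, and the powers of
x, bounded almost everywhere, join the density ρ. -/
lemma isRegularOsc_of_polynomial {n₁ n₂ : ℕ} {M₁ : Set (Fin n₁ → ℝ)} {M₂ : Set (Fin n₂ → ℝ)}
    (hM₁ : IsCompact M₁) (hM₂ : IsCompact M₂)
    (R : MvPolynomial ((OscIdx d ⊕ OscIdx d) ⊕ Fin 2) ℂ)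
    {ρ : (Fin n₁ → ℝ) × (Fin n₂ → ℝ) → ℂ}
    (hρ : Integrable ρ ((volume.restrict M₁).prod (volume.restrict M₂)))
    {φ₁ : MvPolynomial (Fin n₁) ℂ} {φ₂ : MvPolynomial (Fin n₂) ℂ}
    (hφ₁ : ∀ m, φ₁.coeff m ∈ K) (hφ₂ : ∀ m, φ₂.coeff m ∈ K)
    {x : (Fin n₁ → ℝ) × (Fin n₂ → ℝ) → ℂ × ℂ}
    (hxφ : ∀ τ, x τ = (MvPolynomial.eval (fun k => (τ.1 k : ℂ)) φ₁,
      MvPolynomial.eval (fun k => (τ.2 k : ℂ)) φ₂))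
    (hx : Measurable x) {C : ℝ}
    (hC : ∀ᵐ τ ∂((volume.restrict M₁).prod (volume.restrict M₂)), ‖x τ‖ ≤ C) :
    IsRegularOsc K V fun Z Y =>
      ∫ τ, ρ τ * (MvPolynomial.eval (Sum.elim (Sum.elim Z Y) ![(x τ).1, (x τ).2]) R *
        Complex.exp (((x τ).1 + (x τ).2 + (x τ).1 * (x τ).2) * spContract (proj V Z) (proj V Y)))
        ∂((volume.restrict M₁).prod (volume.restrict M₂)) := by
  have key : ∀ Z Y : Osc d, ∫ τ, ρ τ * (MvPolynomial.eval (Sum.elim (Sum.elim Z Y)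
        ![(x τ).1, (x τ).2]) R *
        Complex.exp (((x τ).1 + (x τ).2 + (x τ).1 * (x τ).2) * spContract (proj V Z) (proj V Y)))
        ∂((volume.restrict M₁).prod (volume.restrict M₂)) =
      ∑ k ∈ R.support, MvPolynomial.eval (Sum.elim Z Y)
        (.C (R.coeff k) * ∏ b, .X b ^ k (.inl b)) *
        ∫ τ, (ρ τ * ((x τ).1 ^ k (.inr 0) * (x τ).2 ^ k (.inr 1))) *
        Complex.exp (((x τ).1 + (x τ).2 + (x τ).1 * (x τ).2) * spContract (proj V Z) (proj V Y))
        ∂((volume.restrict M₁).prod (volume.restrict M₂)) := fun Z Y => by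
    simp only [← integral_const_mul]
    rw [← integral_finsetSum]
    · refine integral_congr_ae (ae_of_all _ fun τ => ?_)
      simp only [MvPolynomial.eval_eq' _ R, Finset.sum_mul, Finset.mul_sum]
      refine Finset.sum_congr rfl fun k _ => ?_
      rw [Fintype.prod_sum_type]
      simp only [map_mul, map_prod, map_pow, MvPolynomial.eval_X, MvPolynomial.eval_C,
        Sum.elim_inl, Sum.elim_inr, Fin.prod_univ_two, Matrix.cons_val_zero, Matrix.cons_val_one,
        Matrix.cons_val_fin_one]
      ring
    · intro k _
      refine Integrable.const_mul ?_ _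
      simp only [mul_assoc (ρ _)]
      exact integrable_mul_comp_of_bounded hρ hx hC
        (F := fun y => y.1 ^ k (.inr 0) * y.2 ^ k (.inr 1) *
          Complex.exp ((y.1 + y.2 + y.1 * y.2) * spContract (proj V Z) (proj V Y))) (by fun_prop)
  simp only [key]
  refine IsRegularOsc.sum _ fun k _ => IsRegularOscTerm.isRegularOsc ?_
  have := isRegularOscTerm_of_prod (V := V) hM₁ hM₂
    (.C (R.coeff k) * ∏ b, .X b ^ k (.inl b))
    (integrable_mul_comp_of_bounded hρ hx hC
      (F := fun y => y.1 ^ k (.inr 0) * y.2 ^ k (.inr 1)) (by fun_prop)) hφ₁ hφ₂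
  simpa only [hxφ] using this

end RegularFunctions

/-! ### Existence of the star product and its limit. -/

section StarProduct

variable {d : ℕ} {K : Subalgebra ℝ ℂ} {V : Fin (d + 1) → ℝ}

lemma exists_hasStarProduct_of_term (hV : normSqV V = 1) {f₁ f₂ : Osc d → Osc d → ℂ}
    (h₁ : IsRegularOscTerm K V f₁) (h₂ : IsRegularOscTerm K V f₂) :
    ∃ h, HasStarProduct f₁ f₂ h ∧ IsRegularOsc K V h := by
  obtain ⟨P₁, n₁, M₁, ρ₁, φ₁, hM₁, hρ₁, hφ₁, hf₁⟩ := h₁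
  obtain ⟨P₂, n₂, M₂, ρ₂, φ₂, hM₂, hρ₂, hφ₂, hf₂⟩ := h₂
  obtain ⟨R, hR⟩ := exists_polynomial_starClosed_zero V hV P₁ P₂
  set μ := ((volume : Measure (Fin n₁ → ℝ)).restrict M₁).prod
    ((volume : Measure (Fin n₂ → ℝ)).restrict M₂) with hμ
  let ρ : (Fin n₁ → ℝ) × (Fin n₂ → ℝ) → ℂ := fun τ => ρ₁ τ.1 * ρ₂ τ.2
  let x : (Fin n₁ → ℝ) × (Fin n₂ → ℝ) → ℂ × ℂ := fun τ =>
    (MvPolynomial.eval (fun k => (τ.1 k : ℂ)) φ₁, MvPolynomial.eval (fun k => (τ.2 k : ℂ)) φ₂)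
  have hρ : Integrable ρ μ := Integrable.mul_prod hρ₁ hρ₂
  have hxc : Continuous x := by
    refine Continuous.prodMk ?_ ?_
    · exact (MvPolynomial.continuous_eval φ₁).comp (by fun_prop)
    · exact (MvPolynomial.continuous_eval φ₂).comp (by fun_prop)
  obtain ⟨C, hC'⟩ := (hM₁.prod hM₂).exists_bound_of_continuousOn hxc.continuousOn
  have hC : ∀ᵐ τ ∂μ, ‖x τ‖ ≤ C := by
    rw [hμ, Measure.prod_restrict]
    filter_upwards [ae_restrict_mem (hM₁.prod hM₂).measurableSet] with τ hτ using hC' τ hτ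
  -- The product of the two parameter integrals is a single integral over the product measure.
  have hker : ∀ Z Y ε p, damping ε p * starIntegrand f₁ f₂ Z Y p =
      ∫ τ, ρ τ * starKernel V P₁ P₂ Z Y ε p (x τ) ∂μ := fun Z Y ε p => by
    rw [starIntegrand, hf₁, hf₂]
    trans damping ε p * (Complex.exp (-2 * fullContract (onLine p.1) (onLine p.2)) *
      MvPolynomial.eval (Sum.elim (Z + onLine p.1) (Y + onLine p.1)) P₁ *
      MvPolynomial.eval (Sum.elim (Z - onLine p.2) (Y + onLine p.2)) P₂) *
      ∫ τ, (ρ₁ τ.1 * Complex.exp ((x τ).1 *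
        spContract (proj V (Z + onLine p.1)) (proj V (Y + onLine p.1)))) *
        (ρ₂ τ.2 * Complex.exp ((x τ).2 *
        spContract (proj V (Z - onLine p.2)) (proj V (Y + onLine p.2)))) ∂μ
    · rw [hμ, integral_prod_mul (fun τ => ρ₁ τ * Complex.exp
          (MvPolynomial.eval (fun k => (τ k : ℂ)) φ₁ *
          spContract (proj V (Z + onLine p.1)) (proj V (Y + onLine p.1))))
        (fun τ => ρ₂ τ * Complex.exp (MvPolynomial.eval (fun k => (τ k : ℂ)) φ₂ *
          spContract (proj V (Z - onLine p.2)) (proj V (Y + onLine p.2))))]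
      ring
    · rw [← integral_const_mul]
      refine integral_congr_ae (ae_of_all _ fun τ => ?_)
      simp only [starKernel, ρ]
      ring
  have hint : ∀ Z Y (ε : ℝ), 0 < ε → Integrable (Function.uncurry fun p τ =>
      ρ τ * starKernel V P₁ P₂ Z Y ε p (x τ)) (volume.prod μ) := fun Z Y ε hε => by
    obtain ⟨G, hG, hle⟩ := exists_integrable_starKernel_le V P₁ P₂ Z Y hε C
    exact integrable_superposition hρ hxc.measurable hC
      (continuous_starKernel V P₁ P₂ Z Y ε) hG hle
  have hval : ∀ Z Y (ε : ℝ), 0 < ε → ∫ p, damping ε p * starIntegrand f₁ f₂ Z Y p =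
      ∫ τ, ρ τ * starClosed V P₁ P₂ Z Y ε (x τ) ∂μ := fun Z Y ε hε => by
    simp only [hker]
    rw [integral_integral_swap (hint Z Y ε hε)]
    simp only [integral_const_mul, integral_starKernel V P₁ P₂ Z Y hε]
  -- The witness is the superposition of the `ε = 0` closed forms, with the power of π cancelled by
  -- the normalization.
  refine ⟨fun Z Y => ∫ τ, ρ τ *
    (MvPolynomial.eval (Sum.elim (Sum.elim Z Y) ![(x τ).1, (x τ).2]) R *
      Complex.exp (((x τ).1 + (x τ).2 + (x τ).1 * (x τ).2) * spContract (proj V Z) (proj V Y)))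
      ∂μ, fun Z Y => ⟨fun ε hε => ?_, ?_⟩,
    isRegularOsc_of_polynomial hM₁ hM₂ R hρ hφ₁ hφ₂ (fun _ => rfl) hxc.measurable hC⟩
  · simp only [hker]
    exact (hint Z Y ε hε).integral_prod_left
  · have hlim : Tendsto (fun ε : ℝ => ∫ τ, ρ τ * starClosed V P₁ P₂ Z Y ε (x τ) ∂μ) (𝓝[>] 0)
        (𝓝 (∫ τ, ρ τ * starClosed V P₁ P₂ Z Y 0 (x τ) ∂μ)) := by
      have hcont := continuous_starClosed V P₁ P₂ Z Y
      -- The closed form is jointly continuous, hence bounded for `ε` in `[0, 1]` and x in the ball;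
      -- this gives the dominating function.
      obtain ⟨B, hB⟩ := ((isCompact_Icc (a := (0 : ℝ)) (b := 1)).prod
        (isCompact_closedBall (0 : ℂ × ℂ) C)).exists_bound_of_continuousOn hcont.continuousOn
      refine tendsto_integral_filter_of_dominated_convergence (fun τ => ‖ρ τ‖ * B) ?_ ?_
        (hρ.norm.mul_const B) (ae_of_all _ fun τ => ?_)
      · exact Eventually.of_forall fun ε => hρ.aestronglyMeasurable.mul
          (hcont.comp (by fun_prop : Continuous fun τ => (ε, x τ))).aestronglyMeasurable
      · filter_upwards [Ioo_mem_nhdsGT (zero_lt_one' ℝ)] with ε hε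
        filter_upwards [hC] with τ hτ
        rw [norm_mul]
        exact mul_le_mul_of_nonneg_left
          (hB (ε, x τ) ⟨⟨hε.1.le, hε.2.le⟩, by simpa using hτ⟩) (norm_nonneg _)
      · refine Tendsto.const_mul _ (tendsto_nhdsWithin_of_tendsto_nhds ?_)
        exact (hcont.comp (by fun_prop : Continuous fun ε : ℝ => (ε, x τ))).tendsto 0
    have hpi : (Real.pi : ℂ) ^ (2 * (d + 1)) ≠ 0 :=
      pow_ne_zero _ (by exact_mod_cast Real.pi_ne_zero)
    have hlim' := hlim.const_mul ((Real.pi : ℂ) ^ (2 * (d + 1)))⁻¹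
    simp only [hR, mul_left_comm (ρ _) ((Real.pi : ℂ) ^ (2 * (d + 1)))] at hlim'
    rw [integral_const_mul, inv_mul_cancel_left₀ hpi] at hlim'
    refine hlim'.congr' ?_
    filter_upwards [self_mem_nhdsWithin] with ε hε
    rw [hval Z Y ε hε]

/-- Absolute convergence at each positive `ε` allows the damped integral to be split before passing
to the limit. -/
lemma HasStarProduct.sum {κ κ' : Type*} [Fintype κ] [Fintype κ'] {f : κ → Osc d → Osc d → ℂ}
    {g : κ' → Osc d → Osc d → ℂ} {h : κ → κ' → Osc d → Osc d → ℂ}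
    (H : ∀ k l, HasStarProduct (f k) (g l) (h k l)) :
    HasStarProduct (fun Z Y => ∑ k, f k Z Y) (fun Z Y => ∑ l, g l Z Y)
      fun Z Y => ∑ k, ∑ l, h k l Z Y := by
  intro Z Y
  have e : ∀ (ε : ℝ) (p : (OscIdx d → ℝ) × (OscIdx d → ℝ)),
      damping ε p * starIntegrand (fun Z Y => ∑ k, f k Z Y) (fun Z Y => ∑ l, g l Z Y) Z Y p =
        ∑ k, ∑ l, damping ε p * starIntegrand (f k) (g l) Z Y p := fun ε p => by
    simp only [starIntegrand, Finset.mul_sum, Finset.sum_mul]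
    exact Finset.sum_comm
  simp only [e]
  have hi : ∀ ε : ℝ, 0 < ε → ∀ k, Integrable fun p => ∑ l,
      damping ε p * starIntegrand (f k) (g l) Z Y p := fun ε hε k =>
    integrable_finsetSum _ fun l _ => (H k l Z Y).1 ε hε
  refine ⟨fun ε hε => integrable_finsetSum _ fun k _ => hi ε hε k, ?_⟩
  refine (tendsto_finsetSum _ fun k _ => tendsto_finsetSum _ fun l _ =>
    (H k l Z Y).2).congr' ?_
  filter_upwards [self_mem_nhdsWithin] with ε hε
  rw [integral_finsetSum _ fun k _ => hi ε hε k, Finset.mul_sum]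
  refine Finset.sum_congr rfl fun k _ => ?_
  rw [integral_finsetSum _ fun l _ => (H k l Z Y).1 ε hε, Finset.mul_sum]

end StarProduct

theorem mainTheorem1 (d : ℕ) (V : Fin (d + 1) → ℝ) (hV : normSqV V = 1)
    (K : Subalgebra ℝ ℂ) (f₁ f₂ : Osc d → Osc d → ℂ)
    (h₁ : IsRegularOsc K V f₁) (h₂ : IsRegularOsc K V f₂) :
    ∃ h : Osc d → Osc d → ℂ, HasStarProduct f₁ f₂ h ∧ IsRegularOsc K V h := by
  obtain ⟨N, g, hg, hf₁⟩ := h₁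
  obtain ⟨N', g', hg', hf₂⟩ := h₂
  obtain rfl : f₁ = fun Z Y => ∑ k, g k Z Y := funext₂ hf₁
  obtain rfl : f₂ = fun Z Y => ∑ k, g' k Z Y := funext₂ hf₂
  choose h hh hreg using fun k l => exists_hasStarProduct_of_term hV (hg k) (hg' l)
  exact ⟨_, HasStarProduct.sum hh,
    IsRegularOsc.sum _ fun k _ => IsRegularOsc.sum _ fun l _ => hreg k l⟩
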